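/- Let $n\in\mathbb N=\{0,1,2,\dots\}$ and let $G:\mathbb R^+=[0,\infty)\to\mathbb C$ satisfy $G\in L^1(\mathbb R^+)\cap L^\infty(\mathbb R^+)$, $$\int_0^\infty t^4|G(t)|^2\,dt<\infty,\qquad \int_0^\infty t^n|G(t)|\,dt<\infty,$$ and $$D_G(z):=1-\int_0^\infty G(t)e^{-izt}\,dt\neq 0\quad\text{for every } z\in\mathbb C \text{ with } \operatorname{Im} z\le 0 .$$ For $F:\mathbb R^+\to\mathbb C$, a solution of the Volterra equation $$R(t)=F(t)+\int_0^t G(t-s)R(s)\,ds,\qquad t\in\mathbb R^+, \tag{V}$$ means a locally integrable function $R:\mathbb R^+\to\mathbb C$ such that, for every $t\ge 0$, the integral converges absolutely and the equality holds. Then every locally integrable $F:\mathbb R^+\to\mathbb C$ admits exactly one solution of (V). Moreover there is a constant $C_{n,G}\in[0,\infty)$, depending only on $n$ and $G$, such that for every function $F:\mathbb R^+\to\mathbb C$ and every solution $R$ of (V), $$\sup_{t\in[0,T]}(1+t)^n|R(t)|\le C_{n,G}\,\sup_{t\in[0,T]}(1+t)^n|F(t)|\qquad\text{for all } T>0,$$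 where the suprema are taken in $[0,\infty]$. -/

import Mathlib

open Set MeasureTheory
open scoped NNReal ENNReal

/-- `D_G(z) = 1 - ∫_0^∞ G(t) e^{-izt} dt`; the integral converges absolutely when
`G ∈ L¹(ℝ⁺)` and `Im z ≤ 0`. -/
noncomputable def volterraSymbol (G : ℝ → ℂ) (z : ℂ) : ℂ :=
  1 - ∫ t in Ioi (0 : ℝ), G t * Complex.exp (-(Complex.I * z * (t : ℂ)))

/-- `R` solves the Volterra equation `R(t) = F(t) + ∫_0^t G(t-s) R(s) ds` on `ℝ⁺ = [0, ∞)`: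
`R` is locally integrable on `[0, ∞)`, and at every `t ≥ 0` the integral converges absolutely
and the equation holds. Functions on `ℝ⁺` are represented by functions on `ℝ`
whose values at negative arguments play no role. -/
structure IsVolterraSolution (G F R : ℝ → ℂ) : Prop where
  locallyIntegrableOn : LocallyIntegrableOn R (Ici (0 : ℝ)) volume
  intervalIntegrable : ∀ t : ℝ, 0 ≤ t →
    IntervalIntegrable (fun s => G (t - s) * R s) volume 0 t
  equation : ∀ t : ℝ, 0 ≤ t → R t = F t + ∫ s in (0 : ℝ)..t, G (t - s) * R s

/-- `sup_{t ∈ [0,T]} (1+t)^n |u(t)|`, with value in `[0, ∞]`. -/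
noncomputable def weightedSup (n : ℕ) (T : ℝ) (u : ℝ → ℂ) : ℝ≥0∞ :=
  ⨆ t ∈ Icc (0 : ℝ) T, ENNReal.ofReal ((1 + t) ^ n * ‖u t‖)

/-!
Write `g` for `G` extended by zero to `(-∞, 0]`, and `g ⋆ v` for the convolution. A solution `R`
with right-hand side `F` differs from `F` by `v = g ⋆ R`, which is continuous because `g` is
bounded, and `v - g ⋆ v = g ⋆ F`. So everything reduces to inverting `1 - K`, with `K v = g ⋆ v`,
on the Banach space `CausalSpace` of bounded continuous functions vanishing on `(-∞, 0]`.

The operator `K` is an average of the right shifts `T t`, and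
`K * K = ∫ g t • (T t * K)` converges in operator norm, since translation is continuous in `L¹`
(`CausalSpace.integral_smul_shift_mul_conv`). Gelfand theory in the closed commutative algebra
generated by `K` and the shifts applies: a character with `χ K = 1` restricts to an exponential
`exp (-i z t)`, `Im z ≤ 0`, on the shifts, and the displayed identity turns `χ K = 1` into
`volterraSymbol G z = 0` (`exists_inverse_one_sub_of_symbol_ne_zero`). Hence `1 - K` has an inverse
`J`. It commutes with the shifts, so it is causal: `J f` on `[0, T]` depends only on `f` on `[0, T]`
(`CausalSpace.apply_eq_of_eqOn_Iic`). Causality yields an estimate on `[0, T]` with a constant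
independent of `T`, and it lets a solution for locally integrable `F` be glued from the functions
`J (g ⋆ F 1_[0,T])` (`exists_isVolterraSolution`).

The polynomial weights need no further spectral theory. The commutator of `(1 + t) ^ m` with `K` is
controlled by the weight of order `m - 1` and the `m`-th moment of `g`, so the weighted estimate
follows from the unweighted one by induction (`CausalSpace.exists_weighted_bound`). Uniqueness is
the estimate for the difference of two solutions, for which `F = 0`.
-/

open scoped BoundedContinuousFunction

/-! ### Continuous bounded characters of the half-line -/

/-- A continuous bounded multiplicative function on `[0, ∞)` is an exponential. Integrating
`φ (t + s) = φ t * φ s` in `s` writes `φ` as a difference of primitives of itself; hence `φ` is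
differentiable and solves `φ' = a φ`. -/
theorem exists_eq_exp_of_multiplicative (φ : ℝ → ℂ) (hc : ContinuousOn φ (Ici 0)) (h0 : φ 0 = 1)
    (hmul : ∀ s t, 0 ≤ s → 0 ≤ t → φ (s + t) = φ s * φ t) (hb : ∀ t, 0 ≤ t → ‖φ t‖ ≤ 1) :
    ∃ a : ℂ, a.re ≤ 0 ∧ ∀ t : ℝ, 0 ≤ t → φ t = Complex.exp (a * t) := by
  set ψ : ℝ → ℂ := fun t => φ (max t 0) with hψ
  have hψc : Continuous ψ :=
    hc.comp_continuous (by fun_prop) (fun t => mem_Ici.2 (le_max_right _ _))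
  have hψe : ∀ t, 0 ≤ t → ψ t = φ t := fun t ht => by simp [hψ, max_eq_left ht]
  set P : ℝ → ℂ := fun t => ∫ s in (0 : ℝ)..t, ψ s with hP
  have hPd : ∀ t, HasDerivAt P (ψ t) t := fun t => hψc.integral_hasStrictDerivAt 0 t |>.hasDerivAt
  have hP0 : P 0 = 0 := by simp [hP]
  -- The primitive has derivative `1` at the origin, hence is nonzero just to the right of it.
  obtain ⟨b, hb0, hPb⟩ : ∃ b : ℝ, 0 < b ∧ P b ≠ 0 := by
    have h := (hPd 0).eventually_ne (c := (0 : ℂ)) (by rw [hψe 0 le_rfl, h0]; exact one_ne_zero)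
    have h' := h.filter_mono (nhdsWithin_mono (0 : ℝ) (s := Ioi 0) (t := {0}ᶜ)
      (fun x hx => ne_of_gt hx))
    obtain ⟨b, hb1, hb2⟩ := (h'.and self_mem_nhdsWithin).exists
    exact ⟨b, hb2, hb1⟩
  have hshift : ∀ t, 0 ≤ t → ψ t = (P (t + b) - P t) / P b := by
    intro t ht
    rw [eq_div_iff hPb]
    have h1 : P (t + b) - P t = ∫ s in t..(t + b), ψ s :=
      intervalIntegral.integral_interval_sub_left (hψc.intervalIntegrable _ _)
        (hψc.intervalIntegrable _ _)
    have h2 : ∫ s in t..(t + b), ψ s = ∫ s in (0 : ℝ)..b, ψ (t + s) := by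
      rw [intervalIntegral.integral_comp_add_left]; simp
    rw [h1, h2, hP, ← intervalIntegral.integral_const_mul]
    refine intervalIntegral.integral_congr (fun s hs => ?_)
    rw [uIcc_of_le hb0.le] at hs
    simp only [hψe t ht, hψe s hs.1, hψe (t + s) (add_nonneg ht hs.1), hmul t s ht hs.1]
  set a : ℂ := (φ b - 1) / P b with ha
  have hexp : ∀ t : ℝ, 0 ≤ t → φ t = Complex.exp (a * t) := by
    set q : ℝ → ℂ := fun t => (P (t + b) - P t) / P b * Complex.exp (-(a * t)) with hq
    have hqd : ∀ t, 0 ≤ t → HasDerivAt q 0 t := by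
      intro t ht
      have e1 : HasDerivAt (fun t : ℝ => -(a * (t : ℂ))) (-a) t := by
        have e0 : HasDerivAt (fun t : ℝ => (t : ℂ)) 1 t := Complex.ofRealCLM.hasDerivAt
        exact (e0.const_mul a).neg.congr_deriv (by rw [mul_one])
      have h := ((((hPd (t + b)).comp_add_const t b).sub (hPd t)).div_const (P b)).mul e1.cexp
      refine h.congr_deriv ?_
      simp only [Pi.sub_apply]
      rw [← hshift t ht, hψe t ht, hψe (t + b) (by positivity), hmul t b ht hb0.le, ha]
      field_simp
      ring
    intro t ht
    have hconst : q t = q 0 := by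
      refine constant_of_has_deriv_right_zero (f := q) (a := 0) (b := t) ?_ ?_ t ⟨ht, le_rfl⟩
      · exact fun x hx => (hqd x hx.1).continuousAt.continuousWithinAt
      · exact fun x hx => (hqd x hx.1).hasDerivWithinAt
    simp only [hq, ← hshift t ht, ← hshift 0 le_rfl, hψe t ht, hψe 0 le_rfl, h0] at hconst
    rw [Complex.exp_neg] at hconst
    have := Complex.exp_ne_zero (a * t)
    field_simp at hconst
    simpa using hconst
  refine ⟨a, ?_, hexp⟩
  have h := hb 1 zero_le_one
  rw [hexp 1 zero_le_one, Complex.norm_exp] at h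
  simpa using h

/-! ### Inversion in the algebra generated by a semigroup -/

/-- If `1 - K` were not invertible in the closed commutative algebra generated by `K` and the
semigroup `T`, a character `χ` of that algebra would satisfy `χ K = 1`. Applying `χ` to
`∫ G t • (T t * K) = K * K` gives `∫ G t * χ (T t) = 1`. Since `χ ∘ T` is an exponential
`t ↦ exp (-i z t)` with `Im z ≤ 0`, this says that the symbol vanishes at `z`. The inverse lies in
the commutative algebra, so it commutes with `T`. -/
theorem exists_inverse_one_sub_of_symbol_ne_zero {B : Type*} [NormedRing B] [NormedAlgebra ℂ B]
    [CompleteSpace B] {G : ℝ → ℂ} (hG : IntegrableOn G (Ioi 0))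
    (hD : ∀ z : ℂ, z.im ≤ 0 → volterraSymbol G z ≠ 0)
    (T : ℝ → B) (hT0 : T 0 = 1) (hTadd : ∀ s t, 0 ≤ s → 0 ≤ t → T (s + t) = T s * T t)
    (hTb : ∀ t, 0 ≤ t → ‖T t‖ ≤ 1) (K : B) (hcomm : ∀ t, 0 ≤ t → T t * K = K * T t)
    (hcont : ContinuousOn (fun t => T t * K) (Ici 0))
    (hK : ∫ t in Ioi (0 : ℝ), G t • (T t * K) = K * K) :
    ∃ J : B, J * (1 - K) = 1 ∧ (1 - K) * J = 1 ∧ ∀ t, 0 ≤ t → J * T t = T t * J := by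
  set S : Set B := T '' Ici 0 ∪ {K}
  have hScomm : ∀ x ∈ S, ∀ y ∈ S, x * y = y * x := by
    rintro x (⟨s, hs, rfl⟩ | rfl) y (⟨t, ht, rfl⟩ | rfl)
    · rw [← hTadd s t hs ht, ← hTadd t s ht hs, add_comm]
    · exact hcomm s hs
    · exact (hcomm t ht).symm
    · rfl
  let A0 : Subalgebra ℂ B := Algebra.adjoin ℂ S
  have hA0 : ∀ x y : A0, x * y = y * x := (Algebra.isMulCommutative_adjoin ℂ hScomm).is_comm.comm
  let A : Subalgebra ℂ B := A0.topologicalClosure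
  let _ : NormedCommRing A :=
    { (inferInstance : NormedRing A) with
      mul_comm := (A0.commRingTopologicalClosure hA0).mul_comm }
  have hAc : CompleteSpace A := A0.isClosed_topologicalClosure.completeSpace_coe
  have hmem : ∀ x ∈ S, x ∈ A := fun x hx =>
    A0.le_topologicalClosure (Algebra.subset_adjoin hx)
  have hTm : ∀ t, 0 ≤ t → T t ∈ A := fun t ht => hmem _ (Or.inl ⟨t, ht, rfl⟩)
  let k : A := ⟨K, hmem _ (Or.inr rfl)⟩
  let τ : ℝ → A := fun t => ⟨T (max t 0), hTm _ (le_max_right _ _)⟩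
  have hτ : ∀ t, 0 ≤ t → (τ t : B) = T t := fun t ht => by simp [τ, max_eq_left ht]
  have hτk : Continuous (fun t => τ t * k) := by
    rw [continuous_induced_rng]
    exact hcont.comp_continuous (f := fun t : ℝ => max t 0) (by fun_prop)
      (fun t => mem_Ici.2 (le_max_right _ _))
  have hτkm : AEStronglyMeasurable (fun t => τ t * k) (volume.restrict (Ioi (0 : ℝ))) :=
    have : SecondCountableTopologyEither ℝ A := ⟨Or.inl inferInstance⟩
    hτk.aestronglyMeasurable
  have hunit : IsUnit (1 - k) := by
    by_contra hnu
    obtain ⟨χ, hχ⟩ := WeakDual.CharacterSpace.exists_apply_eq_zero hnu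
    have hχk : χ k = 1 := by
      rw [map_sub, map_one, sub_eq_zero] at hχ
      exact hχ.symm
    have hχc : Continuous χ := map_continuous χ
    set φ : ℝ → ℂ := fun t => χ (τ t) with hφ
    have hφk : ∀ t, φ t = χ (τ t * k) := fun t => by rw [map_mul, hχk, mul_one]
    have hφ0 : φ 0 = 1 := by
      have : τ 0 = 1 := Subtype.ext (by rw [hτ 0 le_rfl, hT0]; rfl)
      simp [hφ, this]
    have hφmul : ∀ s t, 0 ≤ s → 0 ≤ t → φ (s + t) = φ s * φ t := by
      intro s t hs ht
      have : τ (s + t) = τ s * τ t := Subtype.ext (by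
        rw [hτ _ (add_nonneg hs ht), hTadd s t hs ht, ← hτ s hs, ← hτ t ht]; rfl)
      simp only [hφ, this, map_mul]
    have hφb : ∀ t, 0 ≤ t → ‖φ t‖ ≤ 1 := by
      intro t ht
      have h1 : ‖φ t‖ ≤ ‖τ t‖ * ‖(1 : A)‖ :=
        spectrum.norm_le_norm_mul_of_mem (AlgHom.apply_mem_spectrum χ (τ t))
      have h2 : ‖τ t‖ ≤ 1 := (congrArg norm (hτ t ht)).trans_le (hTb t ht)
      have h3 : ‖(1 : A)‖ ≤ 1 := (congrArg norm hT0.symm).trans_le (hTb 0 le_rfl)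
      exact h1.trans (mul_le_one₀ h2 (norm_nonneg _) h3)
    -- Continuity of `φ` comes from `χ K = 1`: only `t ↦ T t * K` is norm continuous, not `T`.
    have hφc : Continuous φ := by
      have : φ = fun t => χ (τ t * k) := funext hφk
      rw [this]; exact hχc.comp hτk
    obtain ⟨a, ha, hexp⟩ := exists_eq_exp_of_multiplicative φ hφc.continuousOn hφ0 hφmul hφb
    -- `exp (-i z t) = exp (a t)` for `z = i a`, and `Im (i a) = Re a ≤ 0`.
    refine hD (Complex.I * a) (by simpa using ha) ?_
    have hint : IntegrableOn (fun t => G t • (τ t * k)) (Ioi 0) := by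
      refine Integrable.mono' (hG.norm.mul_const ‖k‖)
        (hG.aestronglyMeasurable.smul hτkm) ?_
      refine (ae_restrict_iff' measurableSet_Ioi).2 (Filter.Eventually.of_forall fun t ht => ?_)
      rw [norm_smul]
      refine mul_le_mul_of_nonneg_left ((norm_mul_le _ _).trans ?_) (norm_nonneg _)
      refine mul_le_of_le_one_left (norm_nonneg _) ?_
      exact (congrArg norm (hτ t (le_of_lt ht))).trans_le (hTb t (le_of_lt ht))
    have hkk : ∫ t in Ioi (0 : ℝ), G t • (τ t * k) = k * k := by
      apply Subtype.ext
      have h := (A.toSubmodule.subtypeL).integral_comp_comm hint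
      refine h.symm.trans (Eq.trans ?_ hK)
      refine setIntegral_congr_fun measurableSet_Ioi (fun t ht => ?_)
      show G t • ((τ t : B) * K) = _
      rw [hτ t (le_of_lt ht)]
    have h := (WeakDual.CharacterSpace.toCLM χ).integral_comp_comm hint
    rw [hkk] at h
    have h' : ∫ t in Ioi (0 : ℝ), G t * φ t = 1 := by
      calc ∫ t in Ioi (0 : ℝ), G t * φ t = ∫ t in Ioi (0 : ℝ), G t • χ (τ t * k) := by
            simp only [hφk, smul_eq_mul]
        _ = χ (k * k) := by
            refine Eq.trans ?_ h
            refine integral_congr_ae (Filter.Eventually.of_forall fun t => ?_)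
            exact (map_smul χ (G t) (τ t * k)).symm
        _ = 1 := by rw [map_mul, hχk, mul_one]
    rw [volterraSymbol, ← h', sub_eq_zero]
    refine setIntegral_congr_fun measurableSet_Ioi (fun t ht => ?_)
    show G t * φ t = _
    rw [hexp t (le_of_lt ht)]
    congr 2
    linear_combination (a * t) * Complex.I_mul_I
  obtain ⟨u, hu⟩ := hunit
  refine ⟨((↑u⁻¹ : A) : B), ?_, ?_, fun t ht => ?_⟩
  · have := congrArg (Subtype.val) (u.inv_mul); rw [hu] at this; exact this
  · have := congrArg (Subtype.val) (u.mul_inv); rw [hu] at this; exact this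
  · rw [← hτ t ht]
    exact congrArg Subtype.val (mul_comm (↑u⁻¹ : A) (τ t))

/-! ### Translation in `L¹` -/

/-- Translation is continuous in `L¹`. -/
theorem tendsto_integral_norm_translate_sub {g : ℝ → ℂ} (hg : Integrable g) (t₀ : ℝ) :
    Filter.Tendsto (fun t => ∫ s, ‖g (s - t) - g (s - t₀)‖) (nhds t₀) (nhds 0) := by
  have hmp : ∀ t : ℝ, MeasurePreserving (fun s : ℝ => s - t) volume volume :=
    fun t => measurePreserving_sub_right volume t
  let c : ℝ → C(ℝ, ℝ) := fun t => ⟨fun s => s - t, by fun_prop⟩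
  have hc : Continuous c := by
    refine ContinuousMap.continuous_of_continuous_uncurry _ ?_
    show Continuous fun p : ℝ × ℝ => p.2 - p.1
    fun_prop
  let f : Lp ℂ 1 (volume : Measure ℝ) := hg.toL1 g
  have hL := (continuous_const (y := f)).compMeasurePreservingLp hc hmp ENNReal.one_ne_top
  have h := (tendsto_iff_norm_sub_tendsto_zero.1 (hL.tendsto t₀))
  refine h.congr (fun t => ?_)
  rw [L1.norm_eq_integral_norm]
  refine integral_congr_ae ?_
  have key : ∀ t, (Lp.compMeasurePreserving (c t) (hmp t) f : ℝ → ℂ) =ᵐ[volume]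
      fun s => g (s - t) := fun t =>
    (Lp.coeFn_compMeasurePreserving f (hmp t)).trans
      ((hmp t).quasiMeasurePreserving.ae_eq_comp hg.coeFn_toL1)
  filter_upwards [Lp.coeFn_sub (Lp.compMeasurePreserving (c t) (hmp t) f)
    (Lp.compMeasurePreserving (c t₀) (hmp t₀) f), key t, key t₀] with s h1 h2 h3
  rw [h1, Pi.sub_apply, h2, h3]

/-- The convolution of an essentially bounded function with an integrable one is continuous. -/
theorem continuous_integral_mul_comp_sub {g h : ℝ → ℂ} (hgm : AEStronglyMeasurable g)
    {M : ℝ} (hM : ∀ᵐ s, ‖g s‖ ≤ M) (hh : Integrable h) :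
    Continuous (fun x => ∫ s, g s * h (x - s)) := by
  have hint : ∀ x, Integrable (fun s => g s * h (x - s)) := fun x =>
    (hh.comp_sub_left x).bdd_mul hgm hM
  refine continuous_iff_continuousAt.2 fun x₀ => ?_
  rw [ContinuousAt, tendsto_iff_norm_sub_tendsto_zero]
  have hk : Integrable (fun s => h (-s)) := hh.comp_neg
  have hlim := (tendsto_integral_norm_translate_sub hk x₀).const_mul M
  rw [mul_zero] at hlim
  refine squeeze_zero (fun _ => norm_nonneg _) (fun x => ?_) hlim
  rw [← integral_sub (hint x) (hint x₀), ← integral_const_mul]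
  simp only [neg_sub]
  refine norm_integral_le_of_norm_le
    ((((hh.comp_sub_left x).sub (hh.comp_sub_left x₀)).norm).const_mul M) ?_
  filter_upwards [hM] with s hs
  rw [← mul_sub, norm_mul]
  exact mul_le_mul_of_nonneg_right hs (norm_nonneg _)

/-! ### Shifts and convolutions on causal functions -/

/-- The subspace of the bounded continuous functions on `ℝ` that vanish on `(-∞, 0]`. -/
noncomputable def causalSubmodule : Submodule ℂ (ℝ →ᵇ ℂ) where
  carrier := {v | ∀ x ≤ 0, v x = 0}
  add_mem' {v w} hv hw x hx := by simp [hv x hx, hw x hx]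
  zero_mem' x _ := rfl
  smul_mem' c v hv x hx := by simp [hv x hx]

/-- The Banach space of bounded continuous functions on `ℝ` that vanish on `(-∞, 0]`. A type of
its own rather than a coerced submodule, which fixes a single topology on its operators. -/
def CausalSpace : Type := causalSubmodule

noncomputable instance : NormedAddCommGroup CausalSpace :=
  inferInstanceAs (NormedAddCommGroup causalSubmodule)

noncomputable instance : NormedSpace ℂ CausalSpace :=
  inferInstanceAs (NormedSpace ℂ causalSubmodule)

instance : CompleteSpace CausalSpace := by
  have h : IsClosed {v : ℝ →ᵇ ℂ | ∀ x ≤ 0, v x = 0} := by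
    simp only [ofPred_forall]
    exact isClosed_iInter fun x => isClosed_iInter fun _ =>
      isClosed_eq (BoundedContinuousFunction.evalCLM ℂ x).continuous continuous_const
  exact IsClosed.completeSpace_coe (hs := h)

namespace CausalSpace

theorem norm_apply_le (v : CausalSpace) (x : ℝ) : ‖v.1 x‖ ≤ ‖v‖ := v.1.norm_coe_le_norm x

theorem norm_le_of_forall {v : CausalSpace} {C : ℝ} (hC : 0 ≤ C) (h : ∀ x, ‖v.1 x‖ ≤ C) :
    ‖v‖ ≤ C := (BoundedContinuousFunction.norm_le hC).2 h

theorem ext_apply {v w : CausalSpace} (h : ∀ x, v.1 x = w.1 x) : v = w :=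
  Subtype.ext (BoundedContinuousFunction.ext h)

/-- Bounded continuous functions that vanish on `(-∞, 0]`, as elements of `CausalSpace`. -/
noncomputable def mk (v : ℝ → ℂ) (hc : Continuous v) (C : ℝ) (hb : ∀ x, ‖v x‖ ≤ C)
    (h0 : ∀ x ≤ 0, v x = 0) : CausalSpace :=
  ⟨BoundedContinuousFunction.ofNormedAddCommGroup v hc C hb, h0⟩

/-- Translation to the right by the nonnegative part of `s`. Truncating negative `s` makes the
definition total; only `0 ≤ s` matters. -/
noncomputable def shift (s : ℝ) : CausalSpace →L[ℂ] CausalSpace :=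
  LinearMap.mkContinuous
    { toFun := fun v => mk (fun x => v.1 (x - max s 0)) (by fun_prop) ‖v‖
        (fun x => norm_apply_le v _)
        (fun x hx => v.2 _ (by linarith [le_max_right s 0]))
      map_add' := fun _ _ => rfl
      map_smul' := fun _ _ => rfl } 1
    (fun v => by
      rw [one_mul]
      exact norm_le_of_forall (norm_nonneg _) (fun x => norm_apply_le v _))

theorem shift_apply {s : ℝ} (hs : 0 ≤ s) (v : CausalSpace) (x : ℝ) :
    (shift s v).1 x = v.1 (x - s) := by
  show v.1 (x - max s 0) = _
  rw [max_eq_left hs]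

theorem norm_shift_le (s : ℝ) : ‖shift s‖ ≤ 1 := LinearMap.mkContinuous_norm_le _ zero_le_one _

theorem shift_zero : shift 0 = 1 :=
  ContinuousLinearMap.ext fun v => ext_apply fun x => by
    rw [shift_apply le_rfl, sub_zero]; rfl

theorem shift_add {s t : ℝ} (hs : 0 ≤ s) (ht : 0 ≤ t) : shift (s + t) = shift s * shift t :=
  ContinuousLinearMap.ext fun v => ext_apply fun x => by
    show _ = (shift s (shift t v)).1 x
    rw [shift_apply (add_nonneg hs ht), shift_apply hs, shift_apply ht, sub_sub]

theorem integrable_mul_comp {g : ℝ → ℂ} (hg : Integrable g) (v : CausalSpace) (x : ℝ) :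
    Integrable (fun s => g s * v.1 (x - s)) :=
  hg.mul_bdd (c := ‖v‖) (by
    have : Continuous fun s => v.1 (x - s) := by fun_prop
    exact this.aestronglyMeasurable) (Filter.Eventually.of_forall fun s => norm_apply_le v _)

theorem norm_integral_mul_comp_le {g : ℝ → ℂ} (hg : Integrable g) (v : CausalSpace) (x : ℝ) :
    ‖∫ s, g s * v.1 (x - s)‖ ≤ (∫ s, ‖g s‖) * ‖v‖ := by
  rw [← integral_mul_const]
  refine norm_integral_le_of_norm_le (hg.norm.mul_const _) (Filter.Eventually.of_forall fun s => ?_)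
  rw [norm_mul]
  exact mul_le_mul_of_nonneg_left (norm_apply_le v _) (norm_nonneg _)

/-- Convolution with an integrable kernel `g` that vanishes on `(-∞, 0]`. -/
noncomputable def conv (g : ℝ → ℂ) (hg : Integrable g) (h0 : ∀ s ≤ 0, g s = 0) :
    CausalSpace →L[ℂ] CausalSpace :=
  LinearMap.mkContinuous
    { toFun := fun v => mk (fun x => ∫ s, g s * v.1 (x - s))
        (continuous_of_dominated (bound := fun s => ‖g s‖ * ‖v‖)
          (fun x => (integrable_mul_comp hg v x).aestronglyMeasurable)
          (fun x => Filter.Eventually.of_forall fun s => by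
            rw [norm_mul]
            exact mul_le_mul_of_nonneg_left (norm_apply_le v _) (norm_nonneg _))
          (hg.norm.mul_const _)
          (Filter.Eventually.of_forall fun s => by fun_prop))
        _ (norm_integral_mul_comp_le hg v)
        (fun x hx => integral_eq_zero_of_ae (Filter.Eventually.of_forall fun s => by
          rcases le_or_gt s 0 with hs | hs
          · simp [h0 s hs]
          · simp [v.2 (x - s) (by linarith)]))
      map_add' := fun v w => ext_apply fun x => by
        show ∫ s, g s * (v.1 (x - s) + w.1 (x - s)) =
          (∫ s, g s * v.1 (x - s)) + ∫ s, g s * w.1 (x - s)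
        rw [← integral_add (integrable_mul_comp hg v x) (integrable_mul_comp hg w x)]
        simp only [mul_add]
      map_smul' := fun c v => ext_apply fun x => by
        show ∫ s, g s * (c * v.1 (x - s)) = c * ∫ s, g s * v.1 (x - s)
        rw [← integral_const_mul]
        simp only [mul_left_comm] } (∫ s, ‖g s‖)
    (fun v => norm_le_of_forall (by positivity) (norm_integral_mul_comp_le hg v))

variable {g : ℝ → ℂ} (hg : Integrable g) (h0 : ∀ s ≤ 0, g s = 0)

theorem conv_apply (v : CausalSpace) (x : ℝ) :
    (conv g hg h0 v).1 x = ∫ s, g s * v.1 (x - s) := rfl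

theorem shift_mul_conv {t : ℝ} (ht : 0 ≤ t) :
    shift t * conv g hg h0 = conv g hg h0 * shift t :=
  ContinuousLinearMap.ext fun v => ext_apply fun x => by
    show (shift t (conv g hg h0 v)).1 x = (conv g hg h0 (shift t v)).1 x
    rw [shift_apply ht, conv_apply, conv_apply]
    refine integral_congr_ae (Filter.Eventually.of_forall fun s => ?_)
    simp only [shift_apply ht, sub_right_comm]

/-- Strong continuity of translation on `L¹` becomes norm continuity of `t ↦ shift t * conv g`. -/
theorem continuousOn_shift_mul_conv :
    ContinuousOn (fun t => shift t * conv g hg h0) (Ici 0) := by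
  intro t₀ ht₀
  rw [ContinuousWithinAt, tendsto_iff_norm_sub_tendsto_zero]
  refine squeeze_zero' (Filter.Eventually.of_forall fun _ => norm_nonneg _) ?_
    ((tendsto_integral_norm_translate_sub hg t₀).mono_left nhdsWithin_le_nhds)
  filter_upwards [self_mem_nhdsWithin] with t ht
  have hi : ∀ t : ℝ, Integrable (fun s => g (s - t)) := fun t => hg.comp_sub_right t
  have key : ∀ t : ℝ, 0 ≤ t → ∀ (v : CausalSpace) (x : ℝ),
      (shift t (conv g hg h0 v)).1 x = ∫ s, g (s - t) * v.1 (x - s) := by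
    intro t ht v x
    rw [shift_apply ht, conv_apply,
      ← integral_sub_right_eq_self (fun s => g s * v.1 (x - t - s)) t]
    refine integral_congr_ae (Filter.Eventually.of_forall fun s => ?_)
    simp only [sub_sub, add_sub_cancel]
  refine ContinuousLinearMap.opNorm_le_bound _ (by positivity) fun v => ?_
  refine norm_le_of_forall (by positivity) fun x => ?_
  show ‖(shift t (conv g hg h0 v)).1 x - (shift t₀ (conv g hg h0 v)).1 x‖ ≤ _
  rw [key t ht, key t₀ ht₀, ← integral_sub (integrable_mul_comp (hi t) v x)
    (integrable_mul_comp (hi t₀) v x)]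
  simp only [← sub_mul]
  exact norm_integral_mul_comp_le ((hi t).sub (hi t₀)) v x

/-- `conv g * conv g` is the operator-norm Bochner integral of `g t • (shift t * conv g)`. -/
theorem integral_smul_shift_mul_conv :
    ∫ t in Ioi (0 : ℝ), g t • (shift t * conv g hg h0) = conv g hg h0 * conv g hg h0 := by
  set K := conv g hg h0 with hK
  have hc : AEStronglyMeasurable (fun t => shift t * K) (volume.restrict (Ioi (0 : ℝ))) :=
    ((continuousOn_shift_mul_conv hg h0).mono Ioi_subset_Ici_self).aestronglyMeasurable
      measurableSet_Ioi
  have hint : Integrable (fun t => g t • (shift t * K)) (volume.restrict (Ioi (0 : ℝ))) := by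
    refine Integrable.mono' (hg.restrict.norm.mul_const ‖K‖)
      (hg.aestronglyMeasurable.restrict.smul hc) (Filter.Eventually.of_forall fun t => ?_)
    rw [norm_smul]
    refine mul_le_mul_of_nonneg_left ((norm_mul_le _ _).trans ?_) (norm_nonneg _)
    exact mul_le_of_le_one_left (norm_nonneg _) (norm_shift_le t)
  refine ContinuousLinearMap.ext fun v => ext_apply fun x => ?_
  let ev : (CausalSpace →L[ℂ] CausalSpace) →L[ℂ] ℂ :=
    (LinearMap.mkContinuous { toFun := fun w : CausalSpace => w.1 x
                              map_add' := fun _ _ => rfl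
                              map_smul' := fun _ _ => rfl } 1
      (fun w => by rw [one_mul]; exact norm_apply_le w x)).comp
      (ContinuousLinearMap.apply ℂ CausalSpace v)
  have h := ev.integral_comp_comm hint
  refine h.symm.trans ?_
  show ∫ t in Ioi (0 : ℝ), g t * (shift t (K v)).1 x = ∫ s, g s * (K v).1 (x - s)
  rw [← integral_indicator measurableSet_Ioi]
  refine integral_congr_ae (Filter.Eventually.of_forall fun s => ?_)
  rcases le_or_gt s 0 with hs | hs
  · simp [h0 s hs, indicator_of_notMem (show s ∉ Ioi (0 : ℝ) from not_lt.2 hs)]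
  · simp only [indicator_of_mem (show s ∈ Ioi (0 : ℝ) from hs), shift_apply hs.le]

theorem exists_inverse_one_sub_conv (hD : ∀ z : ℂ, z.im ≤ 0 → volterraSymbol g z ≠ 0) :
    ∃ J : CausalSpace →L[ℂ] CausalSpace, J * (1 - conv g hg h0) = 1 ∧
      (1 - conv g hg h0) * J = 1 ∧ ∀ t, 0 ≤ t → J * shift t = shift t * J :=
  exists_inverse_one_sub_of_symbol_ne_zero hg.integrableOn hD shift shift_zero
    (fun _ _ hs ht => shift_add hs ht) (fun t _ => norm_shift_le t) _
    (fun _ ht => shift_mul_conv hg h0 ht) (continuousOn_shift_mul_conv hg h0)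
    (integral_smul_shift_mul_conv hg h0)

/-- An operator commuting with right shifts is causal: on `(-∞, T]` its output depends only on the
input on `(-∞, T]`. -/
theorem apply_eq_of_eqOn_Iic {J : CausalSpace →L[ℂ] CausalSpace}
    (hJ : ∀ t, 0 ≤ t → J * shift t = shift t * J) {T : ℝ} (hT : 0 ≤ T) {v w : CausalSpace}
    (h : ∀ x ≤ T, v.1 x = w.1 x) : ∀ x ≤ T, (J v).1 x = (J w).1 x := by
  intro x hx
  let d : CausalSpace := mk (fun x => (v - w).1 (x + T)) (by fun_prop) ‖v - w‖
    (fun x => norm_apply_le _ _) (fun x hx => sub_eq_zero.2 (h _ (by linarith)))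
  have hd : v - w = shift T d := ext_apply fun y => by
    rw [shift_apply hT]
    exact congrArg (v - w).1 (sub_add_cancel y T).symm
  have h1 : J (v - w) = shift T (J d) := by
    rw [hd]; exact congrArg (fun L => L d) (hJ T hT)
  rw [← sub_eq_zero]
  have h2 : (J v).1 x - (J w).1 x = (J (v - w)).1 x := by rw [map_sub]; rfl
  rw [h2, h1, shift_apply hT]
  exact (J d).2 _ (by linarith)

end CausalSpace

/-! ### Estimates with polynomial weights -/

namespace CausalSpace

/-- The unweighted estimate on `[0, T]`, uniform in `T`: a causal inverse of `1 - K` bounds `v` on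
`[0, T]` by `v - K v` on the same interval. -/
theorem norm_apply_le_of_inverse {K J : CausalSpace →L[ℂ] CausalSpace} (hJK : J * (1 - K) = 1)
    (hJ : ∀ t, 0 ≤ t → J * shift t = shift t * J) {T B : ℝ} (hT : 0 ≤ T) (v : CausalSpace)
    (hB : ∀ y ∈ Icc 0 T, ‖v.1 y - (K v).1 y‖ ≤ B) :
    ∀ y ∈ Icc 0 T, ‖v.1 y‖ ≤ ‖J‖ * B := by
  have hB0 : 0 ≤ B := (norm_nonneg _).trans (hB 0 ⟨le_rfl, hT⟩)
  -- Freezing the right-hand side after time `T` does not affect `v` on `[0, T]`.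
  have hbd : ∀ x, ‖(v - K v).1 (min x T)‖ ≤ B := by
    intro x
    rcases le_or_gt (min x T) 0 with h | h
    · rw [(v - K v).2 _ h, norm_zero]; exact hB0
    · exact hB _ ⟨h.le, min_le_right _ _⟩
  let f : CausalSpace := mk (fun x => (v - K v).1 (min x T)) (by fun_prop) B hbd
    (fun x hx => (v - K v).2 _ ((min_le_left _ _).trans hx))
  have hv : J (v - K v) = v := congrArg (fun L => L v) hJK
  intro y hy
  have h1 : (J (v - K v)).1 y = (J f).1 y :=
    apply_eq_of_eqOn_Iic hJ hT (fun x hx => by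
      show (v - K v).1 x = (v - K v).1 (min x T)
      rw [min_eq_left hx]) y hy.2
  rw [hv] at h1
  rw [h1]
  exact (norm_apply_le _ _).trans ((J.le_opNorm f).trans
    (mul_le_mul_of_nonneg_left (norm_le_of_forall hB0 hbd) (norm_nonneg _)))

end CausalSpace

theorem pow_succ_sub_pow_succ_le {x s : ℝ} (hs : 0 ≤ s) (hsx : s ≤ x) (m : ℕ) :
    |(1 + x) ^ (m + 1) - (1 + (x - s)) ^ (m + 1)| ≤
      (m + 1) * ((1 + s) ^ (m + 1) * (1 + (x - s)) ^ m) := by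
  have h1 := abs_pow_sub_pow_le (1 + x) (1 + (x - s)) (m + 1)
  have e1 : |1 + x - (1 + (x - s))| = s := by
    rw [show 1 + x - (1 + (x - s)) = s by ring, abs_of_nonneg hs]
  have e2 : max |1 + x| |1 + (x - s)| = 1 + x := by
    rw [abs_of_nonneg (by linarith), abs_of_nonneg (by linarith), max_eq_left (by linarith)]
  rw [e1, e2, Nat.add_sub_cancel] at h1
  refine h1.trans ?_
  have h2 : (1 + x) ^ m ≤ (1 + s) ^ m * (1 + (x - s)) ^ m := by
    rw [← mul_pow]
    exact pow_le_pow_left₀ (by linarith) (by nlinarith) m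
  have h3 : s * (1 + x) ^ m ≤ (1 + s) * ((1 + s) ^ m * (1 + (x - s)) ^ m) :=
    mul_le_mul (by linarith) h2 (pow_nonneg (by linarith) m) (by linarith)
  push_cast
  calc s * ((m : ℝ) + 1) * (1 + x) ^ m = (m + 1) * (s * (1 + x) ^ m) := by ring
    _ ≤ (m + 1) * ((1 + s) * ((1 + s) ^ m * (1 + (x - s)) ^ m)) :=
        mul_le_mul_of_nonneg_left h3 (by positivity)
    _ = _ := by ring

namespace CausalSpace

variable {g : ℝ → ℂ} (hg : Integrable g) (h0 : ∀ s ≤ 0, g s = 0)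

/-- The estimate for the weight `(1 + t) ^ m`, by induction on `m`. Applying the unweighted estimate
to `u = (1 + t) ^ m v` leaves the commutator of the weight with `conv g`, whose kernel
`((1 + x) ^ m - (1 + x - s) ^ m) g s` is at most `m (1 + s) ^ m |g s|` times the weight of order
`m - 1` at `x - s`. -/
theorem exists_weighted_bound {J : CausalSpace →L[ℂ] CausalSpace}
    (hJK : J * (1 - conv g hg h0) = 1) (hJ : ∀ t, 0 ≤ t → J * shift t = shift t * J) (m : ℕ)
    (hgm : Integrable (fun s => (1 + |s|) ^ m * ‖g s‖)) :
    ∃ C : ℝ, 0 ≤ C ∧ ∀ (T : ℝ), 0 ≤ T → ∀ (v : CausalSpace) (B : ℝ),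
      (∀ y ∈ Icc 0 T, (1 + y) ^ m * ‖v.1 y - (conv g hg h0 v).1 y‖ ≤ B) →
      ∀ y ∈ Icc 0 T, (1 + y) ^ m * ‖v.1 y‖ ≤ C * B := by
  induction m with
  | zero =>
    refine ⟨‖J‖, norm_nonneg _, fun T hT v B hB y hy => ?_⟩
    simp only [pow_zero, one_mul] at hB ⊢
    exact norm_apply_le_of_inverse hJK hJ hT v hB y hy
  | succ m ih =>
    obtain ⟨C, hC, ih⟩ := ih (by
      have hw : Continuous fun s : ℝ => (1 + |s|) ^ m := by fun_prop
      refine hgm.mono' (hw.aestronglyMeasurable.mul hg.norm.aestronglyMeasurable) (Filter.Eventually.of_forall fun s => ?_)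
      rw [Real.norm_of_nonneg (by positivity)]
      exact mul_le_mul_of_nonneg_right (pow_le_pow_right₀ (by linarith [abs_nonneg s])
        m.le_succ) (norm_nonneg _))
    set N : ℝ := ∫ s, (1 + |s|) ^ (m + 1) * ‖g s‖ with hN
    have hN0 : 0 ≤ N := integral_nonneg fun s => by positivity
    refine ⟨‖J‖ * (1 + N * ((m + 1) * C)), by positivity, fun T hT v B hB y hy => ?_⟩
    have hB0 : 0 ≤ B := le_trans (by positivity) (hB 0 ⟨le_rfl, hT⟩)
    have hA : ∀ y ∈ Icc 0 T, (1 + y) ^ m * ‖v.1 y‖ ≤ C * B := by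
      refine ih T hT v B fun y hy => le_trans ?_ (hB y hy)
      exact mul_le_mul_of_nonneg_right (pow_le_pow_right₀ (by linarith [hy.1]) m.le_succ)
        (norm_nonneg _)
    -- The weight is frozen outside `[0, T]` so that the weighted function stays bounded.
    let W : ℝ → ℂ := fun x => ((1 + max 0 (min x T) : ℝ) : ℂ) ^ (m + 1)
    have hWn : ∀ x, ‖W x‖ = (1 + max 0 (min x T)) ^ (m + 1) := fun x => by
      have : (0 : ℝ) ≤ 1 + max 0 (min x T) := by linarith [le_max_left 0 (min x T)]
      simp only [W, norm_pow, Complex.norm_real, Real.norm_of_nonneg this]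
    have hWe : ∀ x ∈ Icc 0 T, W x = ((1 + x : ℝ) : ℂ) ^ (m + 1) := fun x hx => by
      simp only [W, min_eq_left hx.2, max_eq_right hx.1]
    have hWc : Continuous W := by fun_prop
    let u : CausalSpace := mk (fun x => W x * v.1 x) (by fun_prop) ((1 + T) ^ (m + 1) * ‖v‖)
      (fun x => by
        rw [norm_mul, hWn]
        exact mul_le_mul (pow_le_pow_left₀ (by linarith [le_max_left 0 (min x T)])
          (by linarith [max_le hT (min_le_right x T)]) _) (norm_apply_le v x) (norm_nonneg _)
          (by positivity))
      (fun x hx => by rw [v.2 x hx, mul_zero])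
    have hu : ∀ y ∈ Icc 0 T, ‖u.1 y - (conv g hg h0 u).1 y‖ ≤ B + N * ((m + 1) * (C * B)) := by
      intro x hx
      have e : u.1 x - (conv g hg h0 u).1 x = W x * (v.1 x - (conv g hg h0 v).1 x) +
          ∫ s, g s * ((W x - W (x - s)) * v.1 (x - s)) := by
        have e1 : ∫ s, g s * ((W x - W (x - s)) * v.1 (x - s)) =
            W x * (conv g hg h0 v).1 x - (conv g hg h0 u).1 x := by
          rw [conv_apply, conv_apply, ← integral_const_mul,
            ← integral_sub ((integrable_mul_comp hg v x).const_mul _) (integrable_mul_comp hg u x)]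
          refine integral_congr_ae (Filter.Eventually.of_forall fun s => ?_)
          show _ = W x * (g s * v.1 (x - s)) - g s * (W (x - s) * v.1 (x - s))
          ring
        rw [e1]
        show W x * v.1 x - _ = _
        ring
      rw [e]
      refine (norm_add_le _ _).trans (add_le_add ?_ ?_)
      · rw [norm_mul, hWn, min_eq_left hx.2, max_eq_right hx.1]
        exact hB x hx
      · rw [hN, ← integral_mul_const]
        refine norm_integral_le_of_norm_le (hgm.mul_const _)
          (Filter.Eventually.of_forall fun s => ?_)
        rcases le_or_gt s 0 with hs | hs
        · simp [h0 s hs]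
        rcases le_or_gt x s with hxs | hxs
        · rw [v.2 (x - s) (by linarith), mul_zero, mul_zero, norm_zero]
          positivity
        have hxs' : x - s ∈ Icc 0 T := ⟨by linarith, by linarith [hx.2]⟩
        have h1 := pow_succ_sub_pow_succ_le hs.le hxs.le m
        have h2 : ‖W x - W (x - s)‖ = |(1 + x) ^ (m + 1) - (1 + (x - s)) ^ (m + 1)| := by
          rw [hWe x hx, hWe _ hxs', ← Complex.ofReal_pow, ← Complex.ofReal_pow,
            ← Complex.ofReal_sub, Complex.norm_real, Real.norm_eq_abs]
        rw [norm_mul, norm_mul, h2, abs_of_pos hs]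
        calc ‖g s‖ * (|(1 + x) ^ (m + 1) - (1 + (x - s)) ^ (m + 1)| * ‖v.1 (x - s)‖)
            ≤ ‖g s‖ * ((m + 1) * ((1 + s) ^ (m + 1) * (1 + (x - s)) ^ m) * ‖v.1 (x - s)‖) := by
              gcongr
          _ = (1 + s) ^ (m + 1) * ‖g s‖ * ((m + 1) * ((1 + (x - s)) ^ m * ‖v.1 (x - s)‖)) := by
              ring
          _ ≤ (1 + s) ^ (m + 1) * ‖g s‖ * ((m + 1) * (C * B)) := by
              exact mul_le_mul_of_nonneg_left
                (mul_le_mul_of_nonneg_left (hA _ hxs') (by positivity)) (by positivity)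
    have h := norm_apply_le_of_inverse hJK hJ hT u hu y hy
    have huy : ‖u.1 y‖ = (1 + y) ^ (m + 1) * ‖v.1 y‖ := by
      show ‖W y * v.1 y‖ = _
      rw [norm_mul, hWn, min_eq_left hy.2, max_eq_right hy.1]
    rw [huy] at h
    refine h.trans (le_of_eq ?_)
    ring

end CausalSpace

/-! ### The Volterra equation -/

/-- The integrand of the Volterra equation at `x` agrees with that of a convolution on `ℝ`, where
`k` extends `h` by zero to the negative axis. Null sets matter only at the end points: `G 0` is
replaced by `0`, and `h x` may differ from `k x`. -/
theorem ae_eq_mul_comp_sub {G h k : ℝ → ℂ} {x : ℝ} (hk : ∀ y < 0, k y = 0)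
    (hhk : ∀ y ∈ Ico 0 x, h y = k y) :
    (fun s => (Ioc 0 x).indicator (fun s => G (x - s) * h s) s) =ᵐ[volume]
      fun s => (Ioi (0 : ℝ)).indicator G (x - s) * k s := by
  filter_upwards [compl_mem_ae_iff.2 (measure_singleton (0 : ℝ)),
    compl_mem_ae_iff.2 (measure_singleton x)] with s hs0 hsx
  have hs0' : s ≠ 0 := hs0
  have hsx' : s ≠ x := hsx
  rcases lt_or_gt_of_ne hs0' with hs | hs
  · rw [hk s hs, mul_zero, indicator_of_notMem (fun hm => not_lt.2 hs.le hm.1)]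
  · rcases lt_or_gt_of_ne hsx' with hx | hx
    · rw [indicator_of_mem (show s ∈ Ioc 0 x from ⟨hs, hx.le⟩),
        indicator_of_mem (show x - s ∈ Ioi (0 : ℝ) from sub_pos.2 hx), hhk s ⟨hs.le, hx⟩]
    · rw [indicator_of_notMem (fun hm : s ∈ Ioc 0 x => not_lt.2 hm.2 hx),
        indicator_of_notMem (fun hm : x - s ∈ Ioi (0 : ℝ) => by
          have : 0 < x - s := hm
          linarith), zero_mul]

theorem integral_mul_comp_sub_eq {G h k : ℝ → ℂ} {x : ℝ} (hx : 0 ≤ x) (hk : ∀ y < 0, k y = 0)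
    (hhk : ∀ y ∈ Ico 0 x, h y = k y) :
    ∫ s in (0 : ℝ)..x, G (x - s) * h s = ∫ s, (Ioi (0 : ℝ)).indicator G s * k (x - s) := by
  rw [intervalIntegral.integral_of_le hx, ← integral_indicator measurableSet_Ioc,
    integral_congr_ae (ae_eq_mul_comp_sub hk hhk),
    ← integral_sub_left_eq_self (fun s => (Ioi (0 : ℝ)).indicator G s * k (x - s)) volume x]
  simp only [sub_sub_cancel]

theorem intervalIntegrable_mul_comp_sub {G h k : ℝ → ℂ} {x : ℝ} (hx : 0 ≤ x)
    (hk : ∀ y < 0, k y = 0) (hhk : ∀ y ∈ Ico 0 x, h y = k y)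
    (hint : Integrable (fun s => (Ioi (0 : ℝ)).indicator G s * k (x - s))) :
    IntervalIntegrable (fun s => G (x - s) * h s) volume 0 x := by
  rw [intervalIntegrable_iff_integrableOn_Ioc_of_le hx,
    ← integrable_indicator_iff measurableSet_Ioc]
  have h1 := hint.comp_sub_left x
  simp only [sub_sub_cancel] at h1
  exact h1.congr (ae_eq_mul_comp_sub hk hhk).symm

theorem weightedSup_le_iff {n : ℕ} {T : ℝ} {u : ℝ → ℂ} {b : ℝ≥0∞} :
    weightedSup n T u ≤ b ↔ ∀ t ∈ Icc (0 : ℝ) T, ENNReal.ofReal ((1 + t) ^ n * ‖u t‖) ≤ b :=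
  iSup₂_le_iff

theorem integrable_indicator_Icc {h : ℝ → ℂ}
    (hh : LocallyIntegrableOn h (Ici (0 : ℝ)) volume) (T : ℝ) :
    Integrable ((Icc 0 T).indicator h) :=
  (integrable_indicator_iff measurableSet_Icc).2
    (hh.integrableOn_compact_subset (fun _ hx => hx.1) isCompact_Icc)

theorem CausalSpace.exists_eq_integral {g h : ℝ → ℂ} (hg : AEStronglyMeasurable g)
    (h0 : ∀ s ≤ 0, g s = 0) {M : ℝ} (hM : ∀ᵐ s, ‖g s‖ ≤ M) (hh : Integrable h)
    (hh0 : ∀ y < 0, h y = 0) :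
    ∃ v : CausalSpace, ∀ x, v.1 x = ∫ s, g s * h (x - s) := by
  refine ⟨mk (fun x => ∫ s, g s * h (x - s)) (continuous_integral_mul_comp_sub hg hM hh)
    (M * ∫ s, ‖h s‖) (fun x => ?_) (fun x hx => ?_), fun x => rfl⟩
  · rw [← integral_sub_left_eq_self (fun s => ‖h s‖) volume x, ← integral_const_mul]
    refine norm_integral_le_of_norm_le ((hh.comp_sub_left x).norm.const_mul M) ?_
    filter_upwards [hM] with s hs
    rw [norm_mul]
    exact mul_le_mul_of_nonneg_right hs (norm_nonneg _)
  · refine integral_eq_zero_of_ae (Filter.Eventually.of_forall fun s => ?_)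
    rcases le_or_gt s 0 with hs | hs
    · simp [h0 s hs]
    · simp [hh0 (x - s) (by linarith)]

/-- The bound transfers from `F` to a solution `R`: the correction `v = R - F = g ⋆ R` lies in
`CausalSpace` and satisfies `v - g ⋆ v = g ⋆ F` on `[0, T]`. -/
theorem IsVolterraSolution.weighted_bound {G : ℝ → ℂ} {n : ℕ} {M C : ℝ}
    (hg : Integrable ((Ioi (0 : ℝ)).indicator G))
    (h0 : ∀ s ≤ 0, (Ioi (0 : ℝ)).indicator G s = 0)
    (hM : ∀ᵐ s, ‖(Ioi (0 : ℝ)).indicator G s‖ ≤ M)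
    (hgn : Integrable (fun s => (1 + |s|) ^ n * ‖(Ioi (0 : ℝ)).indicator G s‖))
    (hC : ∀ (T : ℝ), 0 ≤ T → ∀ (v : CausalSpace) (B : ℝ),
      (∀ y ∈ Icc 0 T, (1 + y) ^ n * ‖v.1 y - (CausalSpace.conv _ hg h0 v).1 y‖ ≤ B) →
      ∀ y ∈ Icc 0 T, (1 + y) ^ n * ‖v.1 y‖ ≤ C * B)
    {F R : ℝ → ℂ} (hR : IsVolterraSolution G F R) {T B : ℝ} (hT : 0 ≤ T)
    (hB : ∀ y ∈ Icc 0 T, (1 + y) ^ n * ‖F y‖ ≤ B) :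
    ∀ y ∈ Icc 0 T, (1 + y) ^ n * ‖R y‖ ≤
      (1 + C * ∫ s, (1 + |s|) ^ n * ‖(Ioi (0 : ℝ)).indicator G s‖) * B := by
  set g := (Ioi (0 : ℝ)).indicator G
  set N : ℝ := ∫ s, (1 + |s|) ^ n * ‖g s‖ with hN
  have hB0 : 0 ≤ B := le_trans (by positivity) (hB 0 ⟨le_rfl, hT⟩)
  have hRi := integrable_indicator_Icc hR.locallyIntegrableOn T
  set r := (Icc 0 T).indicator R
  have hr0 : ∀ y < 0, r y = 0 := fun y hy => indicator_of_notMem (fun h => not_lt.2 h.1 hy) _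
  have hre : ∀ y ∈ Icc 0 T, r y = R y := fun y hy => indicator_of_mem hy _
  obtain ⟨v, hv⟩ := CausalSpace.exists_eq_integral hg.aestronglyMeasurable h0 hM hRi hr0
  have hRv : ∀ x ∈ Icc 0 T, R x = F x + v.1 x := by
    intro x hx
    rw [hR.equation x hx.1, hv, integral_mul_comp_sub_eq hx.1 hr0
      (fun y hy => (hre y ⟨hy.1, hy.2.le.trans hx.2⟩).symm)]
  have hf : ∀ x ∈ Icc 0 T,
      (1 + x) ^ n * ‖v.1 x - (CausalSpace.conv g hg h0 v).1 x‖ ≤ N * B := by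
    intro x hx
    have hint : Integrable (fun s => g s * r (x - s)) :=
      (hRi.comp_sub_left x).bdd_mul hg.aestronglyMeasurable hM
    rw [hv, CausalSpace.conv_apply,
      ← integral_sub hint (CausalSpace.integrable_mul_comp hg v x), hN, ← integral_mul_const]
    have hx1 : 0 ≤ (1 + x) ^ n := pow_nonneg (by linarith [hx.1]) n
    have hnorm : ∀ z : ℂ, (1 + x) ^ n * ‖z‖ = ‖(((1 + x) ^ n : ℝ) : ℂ) * z‖ := fun z => by
      rw [norm_mul, Complex.norm_real, Real.norm_of_nonneg hx1]
    rw [hnorm, ← integral_const_mul]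
    refine norm_integral_le_of_norm_le (hgn.mul_const B) (Filter.Eventually.of_forall fun s => ?_)
    rw [← hnorm, ← mul_sub, norm_mul]
    rcases le_or_gt s 0 with hs | hs
    · simp [h0 s hs]
    rcases lt_or_ge x s with hxs | hxs
    · rw [hr0 _ (by linarith), v.2 (x - s) (by linarith), sub_zero, norm_zero, mul_zero, mul_zero]
      positivity
    have hxs' : x - s ∈ Icc 0 T := ⟨by linarith, by linarith [hx.2]⟩
    rw [hre _ hxs', hRv _ hxs', add_sub_cancel_right, abs_of_pos hs]
    have h1 : (1 + x) ^ n ≤ (1 + s) ^ n * (1 + (x - s)) ^ n := by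
      rw [← mul_pow]
      exact pow_le_pow_left₀ (by linarith) (by nlinarith) n
    calc (1 + x) ^ n * (‖g s‖ * ‖F (x - s)‖)
        ≤ ((1 + s) ^ n * (1 + (x - s)) ^ n) * (‖g s‖ * ‖F (x - s)‖) :=
          mul_le_mul_of_nonneg_right h1 (by positivity)
      _ = ((1 + s) ^ n * ‖g s‖) * ((1 + (x - s)) ^ n * ‖F (x - s)‖) := by ring
      _ ≤ ((1 + s) ^ n * ‖g s‖) * B :=
          mul_le_mul_of_nonneg_left (hB _ hxs') (by positivity)
  intro y hy
  have hvy := hC T hT v _ hf y hy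
  have hy1 : 0 ≤ (1 + y) ^ n := pow_nonneg (by linarith [hy.1]) n
  rw [hRv y hy]
  calc (1 + y) ^ n * ‖F y + v.1 y‖ ≤ (1 + y) ^ n * (‖F y‖ + ‖v.1 y‖) :=
        mul_le_mul_of_nonneg_left (norm_add_le _ _) hy1
    _ = (1 + y) ^ n * ‖F y‖ + (1 + y) ^ n * ‖v.1 y‖ := by ring
    _ ≤ B + C * (N * B) := add_le_add (hB y hy) hvy
    _ = _ := by ring

/-- On `[0, T]` a solution is `F + J (g ⋆ F 1_[0,T])`, where `J` inverts `1 - conv g`; causality of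
`J` makes these local solutions agree where they overlap. -/
theorem exists_isVolterraSolution {G : ℝ → ℂ} {M : ℝ}
    (hg : Integrable ((Ioi (0 : ℝ)).indicator G))
    (h0 : ∀ s ≤ 0, (Ioi (0 : ℝ)).indicator G s = 0)
    (hM : ∀ᵐ s, ‖(Ioi (0 : ℝ)).indicator G s‖ ≤ M)
    {J : CausalSpace →L[ℂ] CausalSpace} (hKJ : (1 - CausalSpace.conv _ hg h0) * J = 1)
    (hJ : ∀ t, 0 ≤ t → J * CausalSpace.shift t = CausalSpace.shift t * J)
    {F : ℝ → ℂ} (hF : LocallyIntegrableOn F (Ici (0 : ℝ)) volume) :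
    ∃ R : ℝ → ℂ, IsVolterraSolution G F R := by
  set g := (Ioi (0 : ℝ)).indicator G
  have hFi := integrable_indicator_Icc hF
  have hF0 : ∀ T, ∀ y < 0, (Icc 0 T).indicator F y = 0 :=
    fun T y hy => indicator_of_notMem (fun h => not_lt.2 h.1 hy) _
  choose f hf using fun T =>
    CausalSpace.exists_eq_integral hg.aestronglyMeasurable h0 hM (hFi T) (hF0 T)
  have hJf : ∀ T x, (J (f T)).1 x = (f T).1 x + (CausalSpace.conv g hg h0 (J (f T))).1 x := by
    intro T x
    have h : J (f T) - CausalSpace.conv g hg h0 (J (f T)) = f T := congrArg (fun L => L (f T)) hKJ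
    have h' : (J (f T)).1 x - (CausalSpace.conv g hg h0 (J (f T))).1 x = (f T).1 x :=
      congrArg (fun w : CausalSpace => w.1 x) h
    rw [← h', sub_add_cancel]
  have hff : ∀ s t, 0 ≤ s → s ≤ t → ∀ x ≤ s, (f s).1 x = (f t).1 x := by
    intro s t hs hst x hx
    rw [hf, hf]
    refine integral_congr_ae (Filter.Eventually.of_forall fun τ => ?_)
    rcases le_or_gt τ 0 with hτ | hτ
    · simp [h0 τ hτ]
    · have hm : x - τ ∈ Icc 0 s ↔ x - τ ∈ Icc 0 t :=
        ⟨fun h => ⟨h.1, h.2.trans hst⟩, fun h => ⟨h.1, by linarith⟩⟩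
      by_cases h : x - τ ∈ Icc 0 s
      · simp only [indicator_of_mem h, indicator_of_mem (hm.1 h)]
      · simp only [indicator_of_notMem h, indicator_of_notMem (fun h' => h (hm.2 h'))]
  set R : ℝ → ℂ := fun t => F t + (J (f t)).1 t with hRdef
  have hR : ∀ T, ∀ t ∈ Icc 0 T, R t = F t + (J (f T)).1 t := by
    intro T t ht
    rw [hRdef]
    simp only
    rw [CausalSpace.apply_eq_of_eqOn_Iic hJ ht.1 (hff t T ht.1 ht.2) t le_rfl]
  -- The right-hand function extends `R` from `[0, t]` and vanishes on the negative axis.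
  have hk0 : ∀ t, ∀ y < 0, (Icc 0 t).indicator F y + (J (f t)).1 y = 0 := fun t y hy => by
    rw [hF0 t y hy, (J (f t)).2 y hy.le, add_zero]
  have hkR : ∀ t, ∀ y ∈ Ico 0 t, R y = (Icc 0 t).indicator F y + (J (f t)).1 y :=
    fun t y hy => by
      rw [hR t y ⟨hy.1, hy.2.le⟩, indicator_of_mem (show y ∈ Icc 0 t from ⟨hy.1, hy.2.le⟩)]
  have hi1 : ∀ t, Integrable (fun s => g s * (Icc 0 t).indicator F (t - s)) := fun t =>
    ((hFi t).comp_sub_left t).bdd_mul hg.aestronglyMeasurable hM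
  have hi2 : ∀ t, Integrable (fun s => g s * (J (f t)).1 (t - s)) := fun t =>
    CausalSpace.integrable_mul_comp hg _ t
  refine ⟨R, ?_, fun t ht => ?_, fun t ht => ?_⟩
  · refine (locallyIntegrableOn_iff isClosed_Ici.isLocallyClosed).2 fun k hk hkc => ?_
    obtain ⟨T, hT⟩ := hkc.bddAbove
    have hsub : k ⊆ Icc 0 T := fun y hy => ⟨hk hy, hT hy⟩
    have hcont : Continuous fun y => (J (f T)).1 y := by fun_prop
    refine ((hF.integrableOn_compact_subset (fun _ hx => hx.1) isCompact_Icc).add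
      (hcont.continuousOn.integrableOn_compact isCompact_Icc)).congr_fun
      (fun y hy => (hR T y hy).symm) measurableSet_Icc |>.mono_set hsub
  · refine intervalIntegrable_mul_comp_sub ht (hk0 t) (hkR t) ?_
    simp only [mul_add]
    exact (hi1 t).add (hi2 t)
  · rw [integral_mul_comp_sub_eq ht (hk0 t) (hkR t)]
    simp only [mul_add]
    rw [integral_add (hi1 t) (hi2 t), ← hf, ← CausalSpace.conv_apply hg h0, ← hJf]

theorem IsVolterraSolution.sub {G F R R' : ℝ → ℂ} (h : IsVolterraSolution G F R)
    (h' : IsVolterraSolution G F R') :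
    IsVolterraSolution G 0 (fun t => R' t - R t) where
  locallyIntegrableOn := h'.locallyIntegrableOn.sub h.locallyIntegrableOn
  intervalIntegrable t ht := by
    simp only [mul_sub]
    exact (h'.intervalIntegrable t ht).sub (h.intervalIntegrable t ht)
  equation t ht := by
    simp only [mul_sub, Pi.zero_apply, zero_add]
    rw [intervalIntegral.integral_sub (h'.intervalIntegrable t ht) (h.intervalIntegrable t ht),
      h'.equation t ht, h.equation t ht]
    ring

theorem mainTheorem2 (n : ℕ) (G : ℝ → ℂ)
    (hG1 : IntegrableOn G (Ioi (0 : ℝ)) volume)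
    (hGinf : MemLp G ∞ (volume.restrict (Ioi (0 : ℝ))))
    (hG4 : IntegrableOn (fun t : ℝ => t ^ 4 * ‖G t‖ ^ 2) (Ioi (0 : ℝ)) volume)
    (hGn : IntegrableOn (fun t : ℝ => t ^ n * ‖G t‖) (Ioi (0 : ℝ)) volume)
    (hD : ∀ z : ℂ, z.im ≤ 0 → volterraSymbol G z ≠ 0) :
    (∀ F : ℝ → ℂ, LocallyIntegrableOn F (Ici (0 : ℝ)) volume →
      ∃ R : ℝ → ℂ, IsVolterraSolution G F R ∧
        ∀ R' : ℝ → ℂ, IsVolterraSolution G F R' → EqOn R' R (Ici (0 : ℝ))) ∧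
    ∃ C : ℝ≥0, ∀ F R : ℝ → ℂ, IsVolterraSolution G F R →
      ∀ T : ℝ, 0 < T → weightedSup n T R ≤ (C : ℝ≥0∞) * weightedSup n T F := by
  set g := (Ioi (0 : ℝ)).indicator G
  have hg : Integrable g := (integrable_indicator_iff measurableSet_Ioi).2 hG1
  have h0 : ∀ s ≤ 0, g s = 0 := fun s hs => indicator_of_notMem (not_lt.2 hs) _
  have hgG : ∀ s ∈ Ioi (0 : ℝ), g s = G s := fun s hs => indicator_of_mem hs _
  obtain ⟨M, hM⟩ : ∃ M : ℝ, ∀ᵐ s, ‖g s‖ ≤ M := by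
    have hmem : MemLp g ∞ volume := (memLp_indicator_iff_restrict measurableSet_Ioi).2 hGinf
    have hfin : eLpNormEssSup g volume ≠ ∞ := by
      rw [← eLpNorm_exponent_top]
      exact hmem.2.ne
    refine ⟨(eLpNormEssSup g volume).toReal, ?_⟩
    filter_upwards [enorm_ae_le_eLpNormEssSup g volume] with s hs
    rw [← toReal_enorm]
    exact ENNReal.toReal_mono hfin hs
  have hgn : Integrable (fun s => (1 + |s|) ^ n * ‖g s‖) := by
    have h1 : IntegrableOn (fun s => (1 + |s|) ^ n * ‖G s‖) (Ioi 0) := by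
      refine Integrable.mono' ((hG1.norm.add hGn).const_mul ((2 : ℝ) ^ (n - 1)))
        ((by fun_prop : Continuous fun s : ℝ => (1 + |s|) ^ n).aestronglyMeasurable.mul
          hG1.norm.aestronglyMeasurable)
        ((ae_restrict_iff' measurableSet_Ioi).2 (Filter.Eventually.of_forall fun s hs => ?_))
      have hs : 0 < s := hs
      rw [Real.norm_of_nonneg (by positivity), abs_of_pos hs]
      have h := add_pow_le zero_le_one hs.le n
      rw [one_pow] at h
      calc (1 + s) ^ n * ‖G s‖ ≤ 2 ^ (n - 1) * (1 + s ^ n) * ‖G s‖ :=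
            mul_le_mul_of_nonneg_right h (norm_nonneg _)
        _ = 2 ^ (n - 1) * (‖G s‖ + s ^ n * ‖G s‖) := by ring
    refine ((integrable_indicator_iff measurableSet_Ioi).2 h1).congr
      (Filter.Eventually.of_forall fun s => ?_)
    by_cases hs : s ∈ Ioi (0 : ℝ)
    · simp only [indicator_of_mem hs, hgG s hs]
    · simp only [indicator_of_notMem hs, h0 s (not_lt.1 hs), norm_zero, mul_zero]
  have hDg : ∀ z : ℂ, z.im ≤ 0 → volterraSymbol g z ≠ 0 := by
    intro z hz
    have : volterraSymbol g z = volterraSymbol G z := by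
      rw [volterraSymbol, volterraSymbol, setIntegral_congr_fun measurableSet_Ioi]
      exact fun s hs => by simp only [hgG s hs]
    rw [this]
    exact hD z hz
  obtain ⟨J, hJK, hKJ, hJ⟩ := CausalSpace.exists_inverse_one_sub_conv hg h0 hDg
  obtain ⟨C, hC0, hC⟩ := CausalSpace.exists_weighted_bound hg h0 hJK hJ n hgn
  set N : ℝ := ∫ s, (1 + |s|) ^ n * ‖g s‖
  have hN0 : 0 ≤ N := integral_nonneg fun s => by positivity
  have hbound : ∀ F R : ℝ → ℂ, IsVolterraSolution G F R → ∀ T : ℝ, 0 < T →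
      weightedSup n T R ≤ ((1 + C * N).toNNReal : ℝ≥0∞) * weightedSup n T F := by
    intro F R hR T hT
    have hpos : 0 < 1 + C * N := by positivity
    by_cases htop : weightedSup n T F = ∞
    · rw [htop, ENNReal.mul_top (by simpa using hpos)]
      exact le_top
    have hB : ∀ y ∈ Icc 0 T, (1 + y) ^ n * ‖F y‖ ≤ (weightedSup n T F).toReal := fun y hy =>
      (ENNReal.ofReal_le_iff_le_toReal htop).1 (weightedSup_le_iff.1 le_rfl y hy)
    refine weightedSup_le_iff.2 fun t ht => ?_
    have h := hR.weighted_bound hg h0 hM hgn hC hT.le hB t ht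
    refine (ENNReal.ofReal_le_ofReal h).trans (le_of_eq ?_)
    rw [ENNReal.ofReal_mul hpos.le, ENNReal.ofReal_toReal htop]
    rfl
  refine ⟨fun F hF => ?_, _, hbound⟩
  obtain ⟨R, hR⟩ := exists_isVolterraSolution hg h0 hM hKJ hJ hF
  refine ⟨R, hR, fun R' hR' t ht => ?_⟩
  -- The difference of two solutions solves the equation with `F = 0`, so the bound kills it.
  have ht : 0 ≤ t := ht
  have h := hbound _ _ (hR.sub hR') (t + 1) (by linarith)
  have hz : weightedSup n (t + 1) 0 = 0 :=
    le_antisymm (weightedSup_le_iff.2 fun s _ => by simp) zero_le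
  rw [hz, mul_zero] at h
  have h1 := weightedSup_le_iff.1 h t ⟨ht, by linarith⟩
  have h2 : (1 + t) ^ n * ‖R' t - R t‖ ≤ 0 :=
    ENNReal.ofReal_eq_zero.1 (le_antisymm h1 zero_le)
  have h3 : 0 < (1 + t) ^ n := by positivity
  have h4 : ‖R' t - R t‖ ≤ 0 := by
    by_contra hne
    exact absurd h2 (not_le.2 (mul_pos h3 (not_le.1 hne)))
  exact sub_eq_zero.1 (norm_le_zero_iff.1 h4)
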